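/- Let $\mu,\lambda>0$ and let $\mathrm{IG}(\mu,\lambda)$ be the inverse Gaussian distribution, with density $\phi_{\mu,\lambda}(x)=\sqrt{\tfrac{\lambda}{2\pi}}\,e^{\lambda/\mu}\,x^{-3/2}\exp\!\big(-\tfrac{\lambda}{2\mu}\big(\tfrac{x}{\mu}+\tfrac{\mu}{x}\big)\big)$ for $x>0$ and $0$ otherwise. For data $x_1,\dots,x_n>0$ write $\overline{h(x)}=\frac1n\sum_{i=1}^n h(x_i)$ and $\overline{x}=\frac1n\sum_{i=1}^n x_i$, and put $$\hat\lambda_{\mathrm{ML}}=\hat\lambda_{\mathrm{ML}}(x_1,\dots,x_n)=\frac{\overline{x}}{\overline{x}\cdot\overline{1/x}-1}.$$ This is the special case $f(x)=1/x$ of the Stein-type moment estimator $$\hat\lambda_{f}=\frac{\overline{x}^{2}\,\big(2\,\overline{x^2f'(x)}+\overline{x f(x)}\big)}{\overline{x^2f(x)}-\overline{x}^{2}\,\overline{f(x)}},$$ and, for positive data that are not all equal, $(\overline{x},\hat\lambda_{\mathrm{ML}})$ is the unique maximizer of the likelihood $(\mu',\lambda')\mapsto\prod_{i=1}^n\phi_{\mu',\lambda'}(x_i)$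 over $\mu',\lambda'>0$. Let $X_1,X_2,\dots$ be independent and identically distributed according to $\mathrm{IG}(\mu,\lambda)$, and let $\hat\lambda_{\mathrm{ML},n}=\hat\lambda_{\mathrm{ML}}(X_1,\dots,X_n)$. Then $\hat\lambda_{\mathrm{ML},n}$ is asymptotically normally distributed with asymptotic variance $2\lambda^2/n$, that is, $$\sqrt n\,\big(\hat\lambda_{\mathrm{ML},n}-\lambda\big)\ \xrightarrow{\ d\ }\ \mathrm N(0,\,2\lambda^2)\qquad(n\to\infty),$$ and its asymptotic bias is $3\lambda/n$, that is, $\hat\lambda_{\mathrm{ML},n}$ is integrable for all large $n$ and $$\mathbb E\big[\hat\lambda_{\mathrm{ML},n}\big]-\lambda=\frac{3\lambda}{n}+o\!\left(\frac1n\right)\qquad(n\to\infty).$$ -/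

import Mathlib

open MeasureTheory ProbabilityTheory Filter Topology

/-- The density of the inverse Gaussian distribution `IG(μ, l)`. -/
noncomputable def invGaussianPDFReal (μ l x : ℝ) : ℝ :=
  if 0 < x then
    Real.sqrt (l / (2 * Real.pi)) * Real.exp (l / μ) * x ^ (-(3 / 2 : ℝ)) *
      Real.exp (-(l / (2 * μ)) * (x / μ + μ / x))
  else 0

/-- The inverse Gaussian distribution `IG(μ, l)` on `ℝ` (meant for `0 < μ` and `0 < l`). -/
noncomputable def invGaussianMeasure (μ l : ℝ) : Measure ℝ :=
  volume.withDensity (fun x => ENNReal.ofReal (invGaussianPDFReal μ l x))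

/-- The likelihood of the parameters `μ, l` given the data `x₁, …, xₙ`. -/
noncomputable def invGaussianLikelihood {n : ℕ} (x : Fin n → ℝ) (μ l : ℝ) : ℝ :=
  ∏ i, invGaussianPDFReal μ l (x i)

/-- The arithmetic mean of the data `x₁, …, xₙ`. -/
noncomputable def sampleMean {n : ℕ} (x : Fin n → ℝ) : ℝ :=
  (∑ i, x i) / n

/-- The Stein-type moment estimator of the second parameter `l` of `IG(μ, l)`
with weight function `f : (0, ∞) → ℝ`. -/
noncomputable def steinEstimatorIG (f : ℝ → ℝ) {n : ℕ} (x : Fin n → ℝ) : ℝ :=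
  sampleMean x ^ 2 *
      (2 * sampleMean (fun i => x i ^ 2 * deriv f (x i)) + sampleMean (fun i => x i * f (x i))) /
    (sampleMean (fun i => x i ^ 2 * f (x i)) - sampleMean x ^ 2 * sampleMean (fun i => f (x i)))

/-- The maximum likelihood estimator of the second parameter `l` of `IG(μ, l)`. -/
noncomputable def mlEstimatorIG {n : ℕ} (x : Fin n → ℝ) : ℝ :=
  sampleMean x / (sampleMean x * sampleMean (fun i => 1 / x i) - 1)

/-! With `W(x) = (x - μ)² / (μ² x)` the density is a constant times `x^(-3/2) exp(-l W(x) / 2)`, so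
exponential tilting by `x` and `W(x)` stays inside the family and gives their joint transform in
closed form (`integrable_and_integral_exp_invGaussianMeasure`). The estimator is `n / V` with `V = ∑
1 / xᵢ - n² / ∑ xᵢ`. Tilting by `∑ W(Xᵢ)` keeps the sum of the sample inverse Gaussian, which yields
the transform of `V`: it has the law of `T`, a sum of `n - 1` independent copies of `W(X)`
(`identDistrib_invGaussianResidual`), each a chi-square variable with one degree of freedom divided
by `l`. So only `n / T` matters. The mean `1 / l` and variance `2 / l²` of `W(X)`, the central limit
theorem, the strong law and Slutsky's theorem give normality; integrating the Laplace transform of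
`T` gives the exact mean `n l / (n - 3)` for `n ≥ 4`, hence the bias. -/

/-- The relative squared deviation `(x - μ)² / (μ² x)` in the exponent of the density of
`IG(μ, l)`. -/
noncomputable def invGaussianDeviation (μ x : ℝ) : ℝ := (x - μ) ^ 2 / (μ ^ 2 * x)

@[fun_prop]
lemma measurable_invGaussianDeviation (μ : ℝ) : Measurable (invGaussianDeviation μ) := by
  unfold invGaussianDeviation; fun_prop

/-! ### The density and its normalization -/

lemma invGaussianPDFReal_of_pos {μ l x : ℝ} (hμ : 0 < μ) (hx : 0 < x) :
    invGaussianPDFReal μ l x = Real.sqrt (l / (2 * Real.pi)) * x ^ (-(3 / 2 : ℝ)) *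
      Real.exp (-(l / 2) * invGaussianDeviation μ x) := by
  have h : Real.exp (-(l / 2) * invGaussianDeviation μ x) =
      Real.exp (l / μ) * Real.exp (-(l / (2 * μ)) * (x / μ + μ / x)) := by
    rw [← Real.exp_add]
    congr 1
    unfold invGaussianDeviation
    field_simp
    ring
  rw [invGaussianPDFReal, if_pos hx, h]
  ring

lemma invGaussianPDFReal_nonneg (μ l x : ℝ) : 0 ≤ invGaussianPDFReal μ l x := by
  unfold invGaussianPDFReal
  split_ifs <;> positivity

@[fun_prop]
lemma measurable_invGaussianPDFReal (μ l : ℝ) : Measurable (invGaussianPDFReal μ l) := by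
  unfold invGaussianPDFReal
  exact Measurable.ite measurableSet_Ioi (by fun_prop) (by fun_prop)

/-- The inversion `x ↦ μ² / x` preserves the deviation, and its Jacobian exchanges the two weights.
-/
lemma lintegral_rpow_neg_half_mul_exp_deviation {μ : ℝ} (hμ : 0 < μ) (l : ℝ) :
    ∫⁻ x in Set.Ioi 0, ENNReal.ofReal (x ^ (-(1 / 2 : ℝ)) / μ *
        Real.exp (-(l / 2) * invGaussianDeviation μ x)) =
      ∫⁻ x in Set.Ioi 0, ENNReal.ofReal (x ^ (-(3 / 2 : ℝ)) *
        Real.exp (-(l / 2) * invGaussianDeviation μ x)) := by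
  have himg : (fun x : ℝ => μ ^ 2 / x) '' Set.Ioi 0 = Set.Ioi 0 := by
    ext y
    simp only [Set.mem_image, Set.mem_Ioi]
    refine ⟨?_, fun hy => ⟨μ ^ 2 / y, by positivity, by field_simp⟩⟩
    rintro ⟨x, hx, rfl⟩
    positivity
  conv_lhs => rw [← himg]
  rw [lintegral_image_eq_lintegral_abs_deriv_mul (f' := fun x => -(μ ^ 2 / x ^ 2))
    measurableSet_Ioi]
  · refine setLIntegral_congr_fun measurableSet_Ioi fun x hx => ?_
    have hx : (0 : ℝ) < x := hx
    have hdev : invGaussianDeviation μ (μ ^ 2 / x) = invGaussianDeviation μ x := by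
      unfold invGaussianDeviation
      field_simp
      ring
    rw [← ENNReal.ofReal_mul (by positivity), hdev, ← mul_assoc]
    congr 2
    rw [abs_neg, abs_of_pos (by positivity), Real.div_rpow (by positivity) hx.le,
      ← Real.rpow_natCast μ 2, ← Real.rpow_mul hμ.le,
      show (-(3 / 2 : ℝ)) = -(-(1 / 2 : ℝ)) - 2 by norm_num, Real.rpow_sub hx, Real.rpow_neg hx.le]
    norm_num
    rw [Real.rpow_neg_one]
    field_simp
  · intro x hx
    have hx : x ≠ 0 := (Set.mem_Ioi.1 hx).ne'
    have h := ((hasDerivAt_inv hx).const_mul (μ ^ 2)).hasDerivWithinAt (s := Set.Ioi 0)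
    simpa only [div_eq_mul_inv, mul_neg] using h
  · intro x hx y hy h
    have hx : (0 : ℝ) < x := hx
    have hy : (0 : ℝ) < y := hy
    simp only at h
    field_simp at h
    exact h.symm

lemma lintegral_exp_neg_mul_sq {b : ℝ} (hb : 0 < b) :
    ∫⁻ x : ℝ, ENNReal.ofReal (Real.exp (-b * x ^ 2)) =
      ENNReal.ofReal (Real.sqrt (Real.pi / b)) := by
  rw [← integral_gaussian, ofReal_integral_eq_lintegral_ofReal (integrable_exp_neg_mul_sq hb)
    (ae_of_all _ fun x => by positivity)]

lemma image_sqrt_div_sub_inv_sqrt {μ : ℝ} (hμ : 0 < μ) :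
    (fun x : ℝ => √x / μ - (√x)⁻¹) '' Set.Ioi 0 = Set.univ := by
  refine Set.eq_univ_of_forall fun y => ?_
  -- `r = √x` is the positive root of `r² = μ y r + μ`, which is `y = r / μ - 1 / r`.
  set r := (μ * y + √((μ * y) ^ 2 + 4 * μ)) / 2 with hr
  have hlt : |μ * y| < √((μ * y) ^ 2 + 4 * μ) := by
    rw [← Real.sqrt_sq_eq_abs]
    exact Real.sqrt_lt_sqrt (by positivity) (by linarith)
  have hr0 : 0 < r := by
    have := neg_abs_le (μ * y)
    rw [hr]; linarith
  have hsq : √((μ * y) ^ 2 + 4 * μ) ^ 2 = (μ * y) ^ 2 + 4 * μ := Real.sq_sqrt (by positivity)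
  have hq : r ^ 2 = μ * y * r + μ := by
    rw [hr]; linear_combination hsq / 4
  refine ⟨r ^ 2, by simp only [Set.mem_Ioi]; positivity, ?_⟩
  simp only [Real.sqrt_sq hr0.le]
  field_simp
  linarith

/-- The square of `y = √x / μ - 1 / √x` is the deviation, so this substitution in a Gaussian
integral gives half the sum of the integrals with weights `x^(-1/2) / μ` and `x^(-3/2)`. These agree
by inversion. -/
lemma lintegral_rpow_mul_exp_deviation {μ l : ℝ} (hμ : 0 < μ) (hl : 0 < l) :
    ∫⁻ x in Set.Ioi 0, ENNReal.ofReal (x ^ (-(3 / 2 : ℝ)) *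
        Real.exp (-(l / 2) * invGaussianDeviation μ x)) =
      ENNReal.ofReal (Real.sqrt (2 * Real.pi / l)) := by
  have hg := lintegral_exp_neg_mul_sq (half_pos hl)
  rw [← setLIntegral_univ, ← image_sqrt_div_sub_inv_sqrt hμ,
    lintegral_image_eq_lintegral_abs_deriv_mul
      (f' := fun x => (1 / 2) * (x ^ (-(1 / 2 : ℝ)) / μ + x ^ (-(3 / 2 : ℝ)))) measurableSet_Ioi]
    at hg
  · rw [show Real.pi / (l / 2) = 2 * Real.pi / l by field_simp] at hg
    rw [← hg]
    have hsplit : ∀ x ∈ Set.Ioi (0 : ℝ),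
        ENNReal.ofReal |(1 / 2) * (x ^ (-(1 / 2 : ℝ)) / μ + x ^ (-(3 / 2 : ℝ)))| *
          ENNReal.ofReal (Real.exp (-(l / 2) * (√x / μ - (√x)⁻¹) ^ 2)) =
        ENNReal.ofReal (1 / 2) * (ENNReal.ofReal (x ^ (-(1 / 2 : ℝ)) / μ *
            Real.exp (-(l / 2) * invGaussianDeviation μ x)) +
          ENNReal.ofReal (x ^ (-(3 / 2 : ℝ)) *
            Real.exp (-(l / 2) * invGaussianDeviation μ x))) := by
      intro x hx
      have hx : (0 : ℝ) < x := hx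
      have hdev : (√x / μ - (√x)⁻¹) ^ 2 = invGaussianDeviation μ x := by
        unfold invGaussianDeviation
        have h0 : 0 < √x := Real.sqrt_pos.2 hx
        conv_rhs => rw [← Real.sq_sqrt hx.le]
        field_simp
      rw [hdev, ← ENNReal.ofReal_add (by positivity) (by positivity),
        ← ENNReal.ofReal_mul (by positivity), ← ENNReal.ofReal_mul (by positivity),
        abs_of_pos (by positivity)]
      congr 1
      ring
    rw [setLIntegral_congr_fun measurableSet_Ioi hsplit, lintegral_const_mul _ (by fun_prop),
      lintegral_add_left (by fun_prop), lintegral_rpow_neg_half_mul_exp_deviation hμ, ← two_mul,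
      ← mul_assoc, ← ENNReal.ofReal_ofNat 2, ← ENNReal.ofReal_mul (by norm_num)]
    norm_num
  · intro x hx
    have hx : (0 : ℝ) < x := hx
    have h0 : 0 < √x := Real.sqrt_pos.2 hx
    have h := (((Real.hasDerivAt_sqrt hx.ne').div_const μ).sub
      ((Real.hasDerivAt_sqrt hx.ne').inv h0.ne')).hasDerivWithinAt (s := Set.Ioi 0)
    convert! h using 1
    rw [show (-(3 / 2 : ℝ)) = -(1 / 2) - 1 by norm_num, Real.rpow_sub hx, Real.rpow_neg hx.le,
      ← Real.sqrt_eq_rpow, Real.rpow_one, Real.sq_sqrt hx.le]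
    field_simp
    ring
  · refine StrictMonoOn.injOn fun x hx y hy hxy => ?_
    have hx : (0 : ℝ) < x := hx
    have h1 : √x < √y := Real.sqrt_lt_sqrt hx.le hxy
    have h0 : 0 < √x := Real.sqrt_pos.2 hx
    have h2 : (√y)⁻¹ < (√x)⁻¹ := inv_strictAnti₀ h0 h1
    have h3 : √x / μ < √y / μ := by gcongr
    linarith

lemma isProbabilityMeasure_invGaussianMeasure {μ l : ℝ} (hμ : 0 < μ) (hl : 0 < l) :
    IsProbabilityMeasure (invGaussianMeasure μ l) := by
  constructor
  rw [invGaussianMeasure, withDensity_apply _ MeasurableSet.univ, setLIntegral_univ,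
    ← setLIntegral_eq_of_support_subset (s := Set.Ioi 0)]
  · have h : ∀ x ∈ Set.Ioi (0 : ℝ), ENNReal.ofReal (invGaussianPDFReal μ l x) =
        ENNReal.ofReal (Real.sqrt (l / (2 * Real.pi))) * ENNReal.ofReal (x ^ (-(3 / 2 : ℝ)) *
          Real.exp (-(l / 2) * invGaussianDeviation μ x)) := fun x hx => by
      rw [invGaussianPDFReal_of_pos hμ hx, mul_assoc, ENNReal.ofReal_mul (by positivity)]
    rw [setLIntegral_congr_fun measurableSet_Ioi h, lintegral_const_mul _ (by fun_prop),
      lintegral_rpow_mul_exp_deviation hμ hl, ← ENNReal.ofReal_mul (by positivity),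
      ← Real.sqrt_mul (by positivity)]
    have : l / (2 * Real.pi) * (2 * Real.pi / l) = 1 := by field_simp
    simp [this]
  · intro x hx
    by_contra hx0
    simp only [Set.mem_Ioi] at hx0
    exact hx (by simp [invGaussianPDFReal, hx0])

/-! ### Moment generating functions and exponential tilting -/

lemma integrable_and_integral_eq_of_lintegral_ofReal {α : Type*} [MeasurableSpace α]
    {ν : Measure α} {f : α → ℝ} {c : ℝ} (hf : AEStronglyMeasurable f ν) (hf0 : ∀ᵐ x ∂ν, 0 ≤ f x)
    (hc : 0 ≤ c) (h : ∫⁻ x, ENNReal.ofReal (f x) ∂ν = ENNReal.ofReal c) :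
    Integrable f ν ∧ ∫ x, f x ∂ν = c := by
  refine ⟨⟨hf, ?_⟩, ?_⟩
  · rw [hasFiniteIntegral_iff_ofReal hf0, h]
    exact ENNReal.ofReal_lt_top
  · rw [integral_eq_lintegral_of_nonneg_ae hf0 hf, h, ENNReal.toReal_ofReal hc]

/-- If the moment generating functions of two real random variables are finite and agree
near `0`, then the random variables have the same law. -/
theorem map_eq_of_mgf_eventuallyEq {Ω Ω' : Type*} [MeasurableSpace Ω] [MeasurableSpace Ω']
    {P : Measure Ω} {P' : Measure Ω'} [IsFiniteMeasure P] [IsFiniteMeasure P']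
    {X : Ω → ℝ} {Y : Ω' → ℝ} (hX : AEMeasurable X P) (hY : AEMeasurable Y P')
    (hXint : ∀ᶠ t in 𝓝 (0 : ℝ), Integrable (fun ω => Real.exp (t * X ω)) P)
    (hYint : ∀ᶠ t in 𝓝 (0 : ℝ), Integrable (fun ω => Real.exp (t * Y ω)) P')
    (h : ∀ᶠ t in 𝓝 (0 : ℝ), mgf X P t = mgf Y P' t) :
    P.map X = P'.map Y := by
  set U := interior (integrableExpSet X P) ∩ interior (integrableExpSet Y P') with hU
  have h0 : (0 : ℝ) ∈ U :=
    ⟨mem_interior_iff_mem_nhds.2 hXint, mem_interior_iff_mem_nhds.2 hYint⟩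
  have hconv : Convex ℝ U :=
    convex_integrableExpSet.interior.inter convex_integrableExpSet.interior
  -- Both complex transforms are analytic on the vertical strip over `U`, which is convex, and agree
  -- at real points accumulating at `0`. The identity theorem carries this to the imaginary axis,
  -- where they are the characteristic functions.
  have heq : Set.EqOn (complexMGF X P) (complexMGF Y P') {z | z.re ∈ U} := by
    refine AnalyticOnNhd.eqOn_of_preconnected_of_frequently_eq
      (analyticOnNhd_complexMGF.mono fun z hz => hz.1)
      (analyticOnNhd_complexMGF.mono fun z hz => hz.2)
      (hconv.linear_preimage Complex.reLm).isPreconnected (z₀ := 0) (by simpa using h0) ?_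
    have hreal : ∃ᶠ x : ℝ in 𝓝[≠] 0, complexMGF X P x = complexMGF Y P' x := by
      refine Eventually.frequently ?_
      filter_upwards [h.filter_mono nhdsWithin_le_nhds] with x hx
      rw [complexMGF_ofReal, complexMGF_ofReal, hx]
    rw [frequently_iff_seq_forall] at hreal ⊢
    obtain ⟨xs, hxs, hxs_eq⟩ := hreal
    refine ⟨fun n => xs n, ?_, hxs_eq⟩
    rw [tendsto_nhdsWithin_iff] at hxs ⊢
    refine ⟨?_, by simpa using hxs.2⟩
    simpa [Function.comp_def] using (Complex.continuous_ofReal.tendsto 0).comp hxs.1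
  refine Measure.ext_of_charFun ?_
  ext t
  rw [← complexMGF_mul_I hX, ← complexMGF_mul_I hY]
  exact heq (by simpa using h0)

/-- The integral of `exp (t x + u (x - μ)² / (μ² x))` with respect to `IG(μ, l)`. -/
noncomputable def invGaussianJointMGF (μ l t u : ℝ) : ℝ :=
  √(l / (l - 2 * u)) * Real.exp ((l - 2 * u) / μ * (1 - √(1 - 2 * μ ^ 2 * t / (l - 2 * u))))

lemma invGaussianJointMGF_pos {μ l t u : ℝ} (hl : 0 < l) (hu : 2 * u < l) :
    0 < invGaussianJointMGF μ l t u := by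
  have : 0 < l - 2 * u := by linarith
  unfold invGaussianJointMGF
  positivity

/-- Completing the square in the exponent: with `D` the square root, `t = (1 - D²)(l - 2u) / (2μ²)`,
and the tilted density has mean `μ / D` and second parameter `l - 2u`. The prefactor is then the
joint transform, since the new density has mass one. -/
lemma exp_mul_invGaussianPDFReal {μ l t u : ℝ} (hμ : 0 < μ) (hl : 0 < l) (hu : 2 * u < l)
    (ht : 2 * μ ^ 2 * t < l - 2 * u) (x : ℝ) :
    invGaussianPDFReal μ l x * Real.exp (t * x + u * invGaussianDeviation μ x) =
      invGaussianJointMGF μ l t u *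
        invGaussianPDFReal (μ / √(1 - 2 * μ ^ 2 * t / (l - 2 * u))) (l - 2 * u) x := by
  have hl' : 0 < l - 2 * u := by linarith
  have hD2 : 0 < 1 - 2 * μ ^ 2 * t / (l - 2 * u) := by
    rw [sub_pos, div_lt_one hl']; exact ht
  set D := √(1 - 2 * μ ^ 2 * t / (l - 2 * u)) with hD
  have hD0 : 0 < D := Real.sqrt_pos.2 hD2
  have hDsq : D ^ 2 = 1 - 2 * μ ^ 2 * t / (l - 2 * u) := Real.sq_sqrt hD2.le
  by_cases hx : 0 < x
  · rw [invGaussianPDFReal_of_pos hμ hx, invGaussianPDFReal_of_pos (by positivity) hx,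
      invGaussianJointMGF, ← hD]
    have hexp : Real.exp (-(l / 2) * invGaussianDeviation μ x) *
        Real.exp (t * x + u * invGaussianDeviation μ x) =
        Real.exp ((l - 2 * u) / μ * (1 - D)) *
          Real.exp (-((l - 2 * u) / 2) * invGaussianDeviation (μ / D) x) := by
      rw [← Real.exp_add, ← Real.exp_add]
      congr 1
      have ht' : t = (1 - D ^ 2) * (l - 2 * u) / (2 * μ ^ 2) := by
        rw [hDsq]; field_simp; ring
      rw [ht']
      unfold invGaussianDeviation
      field_simp
      ring
    have hsqrt : √(l / (2 * Real.pi)) =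
        √(l / (l - 2 * u)) * √((l - 2 * u) / (2 * Real.pi)) := by
      rw [← Real.sqrt_mul (by positivity)]
      congr 1
      field_simp
    rw [mul_assoc, hexp, hsqrt]
    ring
  · simp [invGaussianPDFReal, hx]

theorem integrable_and_integral_exp_invGaussianMeasure {μ l t u : ℝ} (hμ : 0 < μ) (hl : 0 < l)
    (hu : 2 * u < l) (ht : 2 * μ ^ 2 * t < l - 2 * u) :
    Integrable (fun x => Real.exp (t * x + u * invGaussianDeviation μ x))
        (invGaussianMeasure μ l) ∧
      ∫ x, Real.exp (t * x + u * invGaussianDeviation μ x) ∂(invGaussianMeasure μ l) =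
        invGaussianJointMGF μ l t u := by
  have hl' : 0 < l - 2 * u := by linarith
  have hD2 : 0 < 1 - 2 * μ ^ 2 * t / (l - 2 * u) := by
    rw [sub_pos, div_lt_one hl']; exact ht
  have hC := invGaussianJointMGF_pos (μ := μ) (t := t) hl hu
  refine integrable_and_integral_eq_of_lintegral_ofReal (by fun_prop)
    (ae_of_all _ fun x => by positivity) hC.le ?_
  have := isProbabilityMeasure_invGaussianMeasure (div_pos hμ (Real.sqrt_pos.2 hD2)) hl'
  have h1 := measure_univ
    (μ := invGaussianMeasure (μ / √(1 - 2 * μ ^ 2 * t / (l - 2 * u))) (l - 2 * u))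
  rw [invGaussianMeasure, withDensity_apply _ MeasurableSet.univ, setLIntegral_univ] at h1
  rw [invGaussianMeasure, lintegral_withDensity_eq_lintegral_mul _ (by fun_prop) (by fun_prop)]
  simp only [Pi.mul_apply]
  simp_rw [← ENNReal.ofReal_mul (invGaussianPDFReal_nonneg _ _ _),
    exp_mul_invGaussianPDFReal hμ hl hu ht, ENNReal.ofReal_mul hC.le]
  rw [lintegral_const_mul _ (by fun_prop), h1, mul_one]

lemma ae_invGaussianMeasure_pos_and_ne (μ l c : ℝ) :
    ∀ᵐ x ∂(invGaussianMeasure μ l), 0 < x ∧ x ≠ c := by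
  have hc : ∀ᵐ x ∂(invGaussianMeasure μ l), x ≠ c :=
    (withDensity_absolutelyContinuous _ _).ae_le (Measure.ae_ne volume c)
  filter_upwards [hc, (ae_withDensity_iff (μ := volume)
    (p := fun x => 0 < x) (f := fun x => ENNReal.ofReal (invGaussianPDFReal μ l x))
    (by fun_prop)).2 (ae_of_all _ fun x hx => by
      by_contra h
      exact hx (by simp [invGaussianPDFReal, h]))] with x hx h0 using ⟨h0, hx⟩

lemma iIndepFun_integrable_exp_sum {Ω ι : Type*} [MeasurableSpace Ω] {P : Measure Ω}
    [IsFiniteMeasure P] {Y : ι → Ω → ℝ} (hindep : iIndepFun Y P) (hY : ∀ i, AEMeasurable (Y i) P)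
    (s : Finset ι) {t : ℝ} (hint : ∀ i ∈ s, Integrable (fun ω => Real.exp (t * Y i ω)) P) :
    Integrable (fun ω => Real.exp (t * (∑ i ∈ s, Y i) ω)) P := by
  classical
  induction s using Finset.induction_on with
  | empty => simp
  | insert i s his ih =>
    rw [Finset.sum_insert his]
    exact (hindep.indepFun_finsetSum_of_notMem₀ hY his).symm.integrable_exp_mul_add
      (hint i (Finset.mem_insert_self _ _)) (ih fun j hj => hint j (Finset.mem_insert_of_mem hj))

/-! ### The law of the residual of a sample -/

section InverseGaussianSample

variable {Ω ι : Type*} [MeasurableSpace Ω] {P : Measure Ω} {μ l : ℝ} {X : ι → Ω → ℝ}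

lemma integrable_and_integral_exp_sum [IsProbabilityMeasure P] (hμ : 0 < μ) (hl : 0 < l)
    (hlaw : ∀ i, HasLaw (X i) (invGaussianMeasure μ l) P) (hindep : iIndepFun X P)
    (s : Finset ι) {t u : ℝ} (hu : 2 * u < l) (ht : 2 * μ ^ 2 * t < l - 2 * u) :
    Integrable (fun ω => Real.exp (t * ∑ i ∈ s, X i ω +
        u * ∑ i ∈ s, invGaussianDeviation μ (X i ω))) P ∧
      ∫ ω, Real.exp (t * ∑ i ∈ s, X i ω + u * ∑ i ∈ s, invGaussianDeviation μ (X i ω)) ∂P =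
        invGaussianJointMGF μ l t u ^ s.card := by
  obtain ⟨hint, hval⟩ := integrable_and_integral_exp_invGaussianMeasure hμ hl hu ht
  set φ : ℝ → ℝ := fun x => t * x + u * invGaussianDeviation μ x with hφ
  have hφm : Measurable φ := by fun_prop
  have hY : iIndepFun (fun i ω => φ (X i ω)) P := hindep.comp (fun _ => φ) fun _ => hφm
  have hYm : ∀ i, AEMeasurable (fun ω => φ (X i ω)) P := fun i =>
    hφm.comp_aemeasurable (hlaw i).aemeasurable
  have hYint : ∀ i, Integrable (fun ω => Real.exp (1 * φ (X i ω))) P := fun i => by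
    rw [← (hlaw i).map_eq] at hint
    simpa [Function.comp_def] using hint.comp_aemeasurable (hlaw i).aemeasurable
  have hYval : ∀ i, mgf (fun ω => φ (X i ω)) P 1 = invGaussianJointMGF μ l t u := fun i => by
    rw [mgf, ← hval]
    simpa [Function.comp_def] using (hlaw i).integral_comp hint.aestronglyMeasurable
  have hsum : ∀ ω, t * ∑ i ∈ s, X i ω + u * ∑ i ∈ s, invGaussianDeviation μ (X i ω) =
      1 * (∑ i ∈ s, fun ω => φ (X i ω)) ω := fun ω => by
    simp [hφ, Finset.sum_add_distrib, Finset.mul_sum]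
  simp_rw [hsum]
  refine ⟨iIndepFun_integrable_exp_sum hY hYm s fun i _ => hYint i, ?_⟩
  have := hY.mgf_sum₀ (t := 1) hYm s
  rw [mgf] at this
  rw [this]
  simp [hYval]

/-- The sum of squared deviations `∑ (1 / xᵢ - 1 / x̄)` of a sample, written as the deviations
from `μ` minus the deviation of the sum from its expectation. -/
noncomputable def invGaussianResidual (μ : ℝ) (X : ι → Ω → ℝ) (s : Finset ι) (ω : Ω) : ℝ :=
  ∑ i ∈ s, invGaussianDeviation μ (X i ω) -
    (s.card : ℝ) ^ 2 * invGaussianDeviation (s.card * μ) (∑ i ∈ s, X i ω)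

lemma aemeasurable_finsetSum (hlaw : ∀ i, HasLaw (X i) (invGaussianMeasure μ l) P)
    (s : Finset ι) : AEMeasurable (fun ω => ∑ i ∈ s, X i ω) P :=
  Finset.aemeasurable_fun_sum _ fun i _ => (hlaw i).aemeasurable

lemma aemeasurable_finsetSum_deviation (hlaw : ∀ i, HasLaw (X i) (invGaussianMeasure μ l) P)
    (s : Finset ι) : AEMeasurable (fun ω => ∑ i ∈ s, invGaussianDeviation μ (X i ω)) P :=
  Finset.aemeasurable_fun_sum _ fun i _ =>
    (measurable_invGaussianDeviation μ).comp_aemeasurable (hlaw i).aemeasurable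

lemma aemeasurable_invGaussianResidual (hlaw : ∀ i, HasLaw (X i) (invGaussianMeasure μ l) P)
    (s : Finset ι) : AEMeasurable (invGaussianResidual μ X s) P :=
  (aemeasurable_finsetSum_deviation hlaw s).sub
    (((measurable_invGaussianDeviation _).comp_aemeasurable
      (aemeasurable_finsetSum hlaw s)).const_mul _)

lemma sqrt_one_sub_scaling {n : ℝ} (hn : 0 < n) (μ t l : ℝ) :
    √(1 - 2 * (n * μ) ^ 2 * t / (n ^ 2 * l)) = √(1 - 2 * μ ^ 2 * t / l) := by
  congr 2
  rw [show 2 * (n * μ) ^ 2 * t = n ^ 2 * (2 * μ ^ 2 * t) by ring,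
    mul_div_mul_left _ _ (by positivity)]

/-- If the law of the sample is tilted by the deviations from `μ`, the sum of the observations is
still inverse Gaussian. -/
theorem map_sum_tilted_deviation [IsProbabilityMeasure P] (hμ : 0 < μ) (hl : 0 < l)
    (hlaw : ∀ i, HasLaw (X i) (invGaussianMeasure μ l) P) (hindep : iIndepFun X P)
    {s : Finset ι} (hs : s.Nonempty) {u : ℝ} (hu : 2 * u < l) :
    (P.tilted fun ω => u * ∑ i ∈ s, invGaussianDeviation μ (X i ω)).map
        (fun ω => ∑ i ∈ s, X i ω) =
      invGaussianMeasure (s.card * μ) ((s.card : ℝ) ^ 2 * (l - 2 * u)) := by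
  have hn : (0 : ℝ) < s.card := by exact_mod_cast hs.card_pos
  have hl' : 0 < l - 2 * u := by linarith
  have hnμ : 0 < s.card * μ := by positivity
  have hnl : 0 < (s.card : ℝ) ^ 2 * (l - 2 * u) := by positivity
  obtain ⟨hint0, hval0⟩ := integrable_and_integral_exp_sum hμ hl hlaw hindep s (t := 0) hu
    (by simpa using hl')
  simp only [zero_mul, zero_add] at hint0 hval0
  have := isProbabilityMeasure_invGaussianMeasure hnμ hnl
  have := isProbabilityMeasure_tilted hint0
  have hevent : ∀ᶠ t in 𝓝 (0 : ℝ), 2 * μ ^ 2 * t < l - 2 * u :=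
    ContinuousAt.eventually_lt (by fun_prop) (by fun_prop) (by simpa using hl')
  have hsmall : ∀ t : ℝ, 2 * μ ^ 2 * t < l - 2 * u →
      2 * (s.card * μ) ^ 2 * t < (s.card : ℝ) ^ 2 * (l - 2 * u) - 2 * 0 := fun t ht => by
    nlinarith [mul_lt_mul_of_pos_left ht (pow_pos hn 2)]
  rw [map_eq_of_mgf_eventuallyEq (Y := id)
    (P' := invGaussianMeasure (s.card * μ) ((s.card : ℝ) ^ 2 * (l - 2 * u)))
    ((aemeasurable_finsetSum hlaw s).mono_ac (tilted_absolutelyContinuous _ _)) aemeasurable_id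
    ?_ ?_ ?_, Measure.map_id]
  · filter_upwards [hevent] with t ht
    rw [integrable_tilted_iff hint0]
    have h := (integrable_and_integral_exp_sum hμ hl hlaw hindep s hu ht).1
    simpa [← Real.exp_add, add_comm] using h
  · filter_upwards [hevent] with t ht
    simpa using (integrable_and_integral_exp_invGaussianMeasure (t := t) (u := 0) hnμ hnl
      (by simpa using hnl) (hsmall t ht)).1
  · filter_upwards [hevent] with t ht
    have h1 := (integrable_and_integral_exp_sum hμ hl hlaw hindep s hu ht).2
    have h2 := (integrable_and_integral_exp_invGaussianMeasure (t := t) (u := 0) hnμ hnl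
      (by simpa using hnl) (hsmall t ht)).2
    simp only [zero_mul, add_zero] at h2
    simp only [mgf, id]
    -- The tilted transform is a quotient of `n`-th powers of joint transforms: the square-root
    -- prefactors cancel, and the exponents add up to that of the scaled parameters.
    rw [h2, integral_exp_tilted, hval0]
    simp only [Pi.add_apply]
    simp_rw [add_comm (u * _)]
    rw [h1, ← div_pow]
    have hsqrt : 0 < √(l / (l - 2 * u)) := by positivity
    simp only [invGaussianJointMGF, mul_zero, sub_zero, zero_div, Real.sqrt_one, sub_self,
      Real.exp_zero, mul_one, sqrt_one_sub_scaling hn]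
    rw [mul_div_cancel_left₀ _ hsqrt.ne', ← Real.exp_nat_mul, div_self hnl.ne', Real.sqrt_one,
      one_mul]
    congr 1
    field_simp

/-- Tilting by `t ∑ W(Xᵢ)` contributes the normalizer `√(l / (l - 2t)) ^ n` and makes the sum
inverse Gaussian with second parameter `n² (l - 2t)`. The remaining factor, the exponential of `-t
n²` times the deviation of the sum, moves that parameter back to `n² l` and so has mean `√((l - 2t)
/ l)`, which removes one factor. -/
theorem integrable_and_integral_exp_residual [IsProbabilityMeasure P] (hμ : 0 < μ) (hl : 0 < l)
    (hlaw : ∀ i, HasLaw (X i) (invGaussianMeasure μ l) P) (hindep : iIndepFun X P)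
    {s : Finset ι} (hs : s.Nonempty) {t : ℝ} (ht : 2 * t < l) :
    Integrable (fun ω => Real.exp (t * invGaussianResidual μ X s ω)) P ∧
      mgf (invGaussianResidual μ X s) P t = √(l / (l - 2 * t)) ^ (s.card - 1) := by
  have hn : (0 : ℝ) < s.card := by exact_mod_cast hs.card_pos
  have hl' : 0 < l - 2 * t := by linarith
  have hnμ : 0 < s.card * μ := by positivity
  have hnl : 0 < (s.card : ℝ) ^ 2 * (l - 2 * t) := by positivity
  obtain ⟨hint0, hval0⟩ := integrable_and_integral_exp_sum hμ hl hlaw hindep s (t := 0) ht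
    (by simpa using hl')
  simp only [zero_mul, zero_add] at hint0 hval0
  have hsplit : ∀ ω, t * invGaussianResidual μ X s ω =
      t * ∑ i ∈ s, invGaussianDeviation μ (X i ω) +
        -(t * (s.card : ℝ) ^ 2) * invGaussianDeviation (s.card * μ) (∑ i ∈ s, X i ω) := fun ω => by
    unfold invGaussianResidual; ring
  have hu : 2 * (-(t * (s.card : ℝ) ^ 2)) < (s.card : ℝ) ^ 2 * (l - 2 * t) := by
    nlinarith [mul_pos (pow_pos hn 2) hl]
  obtain ⟨hint, hval⟩ := integrable_and_integral_exp_invGaussianMeasure (t := 0) hnμ hnl hu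
    (by linarith)
  simp only [zero_mul, zero_add] at hint hval
  have hmap := map_sum_tilted_deviation hμ hl hlaw hindep hs ht
  have hSm := (aemeasurable_finsetSum hlaw s).mono_ac (tilted_absolutelyContinuous P
    fun ω => t * ∑ i ∈ s, invGaussianDeviation μ (X i ω))
  rw [← hmap] at hint hval
  rw [integral_map hSm (by fun_prop), integral_exp_tilted, hval0] at hval
  have hint := hint.comp_aemeasurable hSm
  rw [integrable_tilted_iff hint0] at hint
  refine ⟨?_, ?_⟩
  · simp_rw [hsplit, Real.exp_add]
    simpa using hint
  · have hC : 0 < invGaussianJointMGF μ l 0 t := invGaussianJointMGF_pos hl ht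
    rw [div_eq_iff (by positivity)] at hval
    simp only [mgf, hsplit]
    simp only [Pi.add_apply] at hval
    rw [hval]
    obtain ⟨k, hk⟩ : ∃ k, s.card = k + 1 := ⟨s.card - 1, by have := hs.card_pos; omega⟩
    have hden : (s.card : ℝ) ^ 2 * (l - 2 * t) - 2 * (-(t * (s.card : ℝ) ^ 2)) =
        (s.card : ℝ) ^ 2 * l := by ring
    simp only [invGaussianJointMGF, mul_zero, sub_zero, zero_div, Real.sqrt_one, sub_self,
      Real.exp_zero, mul_one, hden]
    rw [mul_div_mul_left _ _ (by positivity), hk, pow_succ', ← mul_assoc,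
      ← Real.sqrt_mul (by positivity)]
    rw [show (l - 2 * t) / l * (l / (l - 2 * t)) = 1 by field_simp]
    simp

/-- The residual sum of a sample of size `n` has the law of the sum of `n - 1` independent
deviations. -/
theorem identDistrib_invGaussianResidual [IsProbabilityMeasure P] (hμ : 0 < μ) (hl : 0 < l)
    (hlaw : ∀ i, HasLaw (X i) (invGaussianMeasure μ l) P) (hindep : iIndepFun X P)
    {s r : Finset ι} (hsr : s.card = r.card + 1) :
    IdentDistrib (invGaussianResidual μ X s)
      (fun ω => ∑ i ∈ r, invGaussianDeviation μ (X i ω)) P P := by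
  have hs : s.Nonempty := Finset.card_pos.1 (by omega)
  have hevent : ∀ᶠ t in 𝓝 (0 : ℝ), 2 * t < l :=
    ContinuousAt.eventually_lt (by fun_prop) (by fun_prop) (by simpa using hl)
  have hdev := fun t ht => integrable_and_integral_exp_sum hμ hl hlaw hindep r (t := 0) (u := t) ht
    (by linarith)
  simp only [zero_mul, zero_add] at hdev
  refine ⟨aemeasurable_invGaussianResidual hlaw s, aemeasurable_finsetSum_deviation hlaw r,
    map_eq_of_mgf_eventuallyEq (aemeasurable_invGaussianResidual hlaw s)
      (aemeasurable_finsetSum_deviation hlaw r) ?_ ?_ ?_⟩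
  · filter_upwards [hevent] with t ht
      using (integrable_and_integral_exp_residual hμ hl hlaw hindep hs ht).1
  · filter_upwards [hevent] with t ht using (hdev t ht).1
  · filter_upwards [hevent] with t ht
    rw [(integrable_and_integral_exp_residual hμ hl hlaw hindep hs ht).2, mgf, (hdev t ht).2]
    simp [invGaussianJointMGF, hsr]

end InverseGaussianSample

/-! ### Moments of the deviations and of the reciprocal of their sum -/

lemma lintegral_Ioi_exp_neg_mul {x : ℝ} (hx : 0 < x) :
    ∫⁻ a in Set.Ioi (0 : ℝ), ENNReal.ofReal (Real.exp (-a * x)) = ENNReal.ofReal (1 / x) := by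
  have hint : IntegrableOn (fun a : ℝ => Real.exp (-a * x)) (Set.Ioi 0) := by
    simpa [mul_comm] using integrableOn_exp_mul_Ioi (neg_neg_of_pos hx) 0
  rw [← ofReal_integral_eq_lintegral_ofReal hint (ae_of_all _ fun a => by positivity)]
  congr 1
  have := integral_exp_mul_Ioi (neg_neg_of_pos hx) 0
  simpa [mul_comm] using this

lemma hasDerivAt_sqrt_div_add {l : ℝ} (hl : 0 < l) {c a : ℝ} (ha : 0 < l + c * a) :
    HasDerivAt (fun a => √(l / (l + c * a))) (-(c / (2 * l)) * √(l / (l + c * a)) ^ 3) a := by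
  have hg : 0 < √(l / (l + c * a)) := by positivity
  have h1 : HasDerivAt (fun a => l / (l + c * a)) (-(l * c) / (l + c * a) ^ 2) a := by
    have h := (hasDerivAt_const a l).div (((hasDerivAt_id a).const_mul c).const_add l) ha.ne'
    convert! h using 1
    simp
  convert! h1.sqrt (by positivity) using 1
  rw [eq_div_iff (by positivity)]
  have hsq : √(l / (l + c * a)) ^ 2 = l / (l + c * a) := Real.sq_sqrt (by positivity)
  rw [show -(c / (2 * l)) * √(l / (l + c * a)) ^ 3 * (2 * √(l / (l + c * a))) =
    -(c / l) * (√(l / (l + c * a)) ^ 2) ^ 2 by ring, hsq]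
  field_simp

/-- The function `g(a) = √(l / (l + 2a))` satisfies `g' = -g³ / l`, so `-(l / (k + 1)) g^(k + 1)` is
an antiderivative. -/
lemma lintegral_Ioi_sqrt_div_pow {l : ℝ} (hl : 0 < l) (k : ℕ) :
    ∫⁻ a in Set.Ioi (0 : ℝ), ENNReal.ofReal (√(l / (l + 2 * a)) ^ (k + 3)) =
      ENNReal.ofReal (l / (k + 1)) := by
  have hderiv : ∀ a ∈ Set.Ici (0 : ℝ),
      HasDerivAt (fun a => -(l / (k + 1)) * √(l / (l + 2 * a)) ^ (k + 1))
        (√(l / (l + 2 * a)) ^ (k + 3)) a := by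
    intro a ha
    have ha : (0 : ℝ) ≤ a := ha
    have h := ((hasDerivAt_sqrt_div_add hl (c := 2) (a := a) (by positivity)).pow
      (k + 1)).const_mul (-(l / (k + 1)))
    convert! h using 1
    push_cast
    field_simp
    ring
  have hlim : Tendsto (fun a => -(l / (k + 1)) * √(l / (l + 2 * a)) ^ (k + 1)) atTop (𝓝 0) := by
    have h1 : Tendsto (fun a : ℝ => l / (l + 2 * a)) atTop (𝓝 0) :=
      tendsto_const_nhds.div_atTop (tendsto_atTop_add_const_left _ _
        (tendsto_id.const_mul_atTop two_pos))
    have h2 := ((h1.sqrt).pow (k + 1)).const_mul (-(l / (k + 1)))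
    simpa using h2
  have hpos : ∀ a ∈ Set.Ioi (0 : ℝ), 0 ≤ √(l / (l + 2 * a)) ^ (k + 3) := fun a _ => by positivity
  rw [← ofReal_integral_eq_lintegral_ofReal (integrableOn_Ioi_deriv_of_nonneg' hderiv hpos hlim)
    (ae_of_all _ fun a => by positivity), integral_Ioi_of_hasDerivAt_of_nonneg' hderiv hpos hlim]
  simp [hl.ne']

section InverseGaussianSample

variable {Ω ι : Type*} [MeasurableSpace Ω] {P : Measure Ω} {μ l : ℝ} {X : ι → Ω → ℝ}

lemma ae_sample_pos_and_ne (hlaw : ∀ i, HasLaw (X i) (invGaussianMeasure μ l) P) (c : ℝ) (i : ι) :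
    ∀ᵐ ω ∂P, 0 < X i ω ∧ X i ω ≠ c :=
  ((hlaw i).ae_iff (p := fun x => 0 < x ∧ x ≠ c) (by measurability)).2
    (ae_invGaussianMeasure_pos_and_ne μ l c)

lemma ae_sum_deviation_pos (hμ : 0 < μ) (hlaw : ∀ i, HasLaw (X i) (invGaussianMeasure μ l) P)
    {s : Finset ι} (hs : s.Nonempty) :
    ∀ᵐ ω ∂P, 0 < ∑ i ∈ s, invGaussianDeviation μ (X i ω) := by
  have h : ∀ᵐ ω ∂P, ∀ i ∈ s, 0 < X i ω ∧ X i ω ≠ μ :=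
    (ae_ball_iff s.countable_toSet).2 fun i _ => ae_sample_pos_and_ne hlaw μ i
  filter_upwards [h] with ω hω
  refine Finset.sum_pos (fun i hi => ?_) hs
  have h0 := (hω i hi).1
  have h1 := sub_ne_zero.2 (hω i hi).2
  unfold invGaussianDeviation
  positivity

/-- Write `1 / T` as the integral of `exp (-a T)` over `a > 0` and apply Tonelli. At least three
terms are needed for the resulting integral to converge, hence the cardinality `k + 3`. -/
theorem integrable_and_integral_inv_sum_deviation [IsProbabilityMeasure P] (hμ : 0 < μ)
    (hl : 0 < l) (hlaw : ∀ i, HasLaw (X i) (invGaussianMeasure μ l) P) (hindep : iIndepFun X P)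
    {s : Finset ι} {k : ℕ} (hs : s.card = k + 3) :
    Integrable (fun ω => 1 / ∑ i ∈ s, invGaussianDeviation μ (X i ω)) P ∧
      ∫ ω, 1 / ∑ i ∈ s, invGaussianDeviation μ (X i ω) ∂P = l / (k + 1) := by
  set T : Ω → ℝ := fun ω => ∑ i ∈ s, invGaussianDeviation μ (X i ω) with hT
  have hTm : AEMeasurable T P := aemeasurable_finsetSum_deviation hlaw s
  have hTpos : ∀ᵐ ω ∂P, 0 < T ω := ae_sum_deviation_pos hμ hlaw (Finset.card_pos.1 (by omega))
  refine integrable_and_integral_eq_of_lintegral_ofReal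
    (hTm.const_div 1).aestronglyMeasurable
    (hTpos.mono fun ω h => by positivity) (by positivity) ?_
  calc ∫⁻ ω, ENNReal.ofReal (1 / T ω) ∂P
      = ∫⁻ ω, (∫⁻ a in Set.Ioi (0 : ℝ), ENNReal.ofReal (Real.exp (-a * T ω))) ∂P :=
        lintegral_congr_ae (hTpos.mono fun ω h => (lintegral_Ioi_exp_neg_mul h).symm)
    _ = ∫⁻ a in Set.Ioi (0 : ℝ), ∫⁻ ω, ENNReal.ofReal (Real.exp (-a * T ω)) ∂P := by
        refine lintegral_lintegral_swap ?_
        have := hTm.comp_fst (ν := volume.restrict (Set.Ioi (0 : ℝ)))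
        exact ((measurable_snd.neg.aemeasurable.mul this).exp).ennreal_ofReal
    _ = ∫⁻ a in Set.Ioi (0 : ℝ), ENNReal.ofReal (√(l / (l + 2 * a)) ^ (k + 3)) := by
        refine setLIntegral_congr_fun measurableSet_Ioi fun a ha => ?_
        have ha : (0 : ℝ) < a := ha
        have h := integrable_and_integral_exp_sum hμ hl hlaw hindep s (t := 0) (u := -a)
          (by linarith) (by linarith)
        simp only [zero_mul, zero_add] at h
        rw [← ofReal_integral_eq_lintegral_ofReal h.1 (ae_of_all _ fun ω => by positivity), h.2]
        simp [invGaussianJointMGF, hs]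
    _ = ENNReal.ofReal (l / (k + 1)) := lintegral_Ioi_sqrt_div_pow hl k

lemma mgf_deviation [IsProbabilityMeasure P] (hμ : 0 < μ) (hl : 0 < l)
    {X : Ω → ℝ} (hX : HasLaw X (invGaussianMeasure μ l) P) {t : ℝ} (ht : 2 * t < l) :
    Integrable (fun ω => Real.exp (t * invGaussianDeviation μ (X ω))) P ∧
      mgf (fun ω => invGaussianDeviation μ (X ω)) P t = √(l / (l + (-2) * t)) := by
  obtain ⟨hint, hval⟩ := integrable_and_integral_exp_invGaussianMeasure (t := 0) hμ hl ht
    (by linarith)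
  simp only [zero_mul, zero_add] at hint hval
  refine ⟨?_, ?_⟩
  · rw [← hX.map_eq] at hint
    exact hint.comp_aemeasurable hX.aemeasurable
  · have h := hX.integral_comp hint.aestronglyMeasurable
    rw [hval] at h
    simpa [mgf, Function.comp_def, invGaussianJointMGF, sub_eq_add_neg] using h

lemma memLp_and_moments_deviation [IsProbabilityMeasure P] (hμ : 0 < μ) (hl : 0 < l)
    {X : Ω → ℝ} (hX : HasLaw X (invGaussianMeasure μ l) P) :
    MemLp (fun ω => invGaussianDeviation μ (X ω)) 2 P ∧
      ∫ ω, invGaussianDeviation μ (X ω) ∂P = 1 / l ∧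
      Var[fun ω => invGaussianDeviation μ (X ω); P] = 2 / l ^ 2 := by
  set W : Ω → ℝ := fun ω => invGaussianDeviation μ (X ω) with hW
  have hevent : ∀ᶠ t in 𝓝 (0 : ℝ), 2 * t < l :=
    ContinuousAt.eventually_lt (by fun_prop) (by fun_prop) (by simpa using hl)
  have hmem : (0 : ℝ) ∈ interior (integrableExpSet W P) :=
    mem_interior_iff_mem_nhds.2 (hevent.mono fun t ht => (mgf_deviation hμ hl hX ht).1)
  have hmgf : mgf W P =ᶠ[𝓝 0] fun t => √(l / (l + (-2) * t)) :=
    hevent.mono fun t ht => (mgf_deviation hμ hl hX ht).2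
  -- The moment generating function `g` satisfies `g' = g³ / l`; differentiating again gives the
  -- second moment `3 / l²`.
  have hd : deriv (fun t => √(l / (l + (-2) * t))) =ᶠ[𝓝 0]
      fun t => 1 / l * √(l / (l + (-2) * t)) ^ 3 := by
    filter_upwards [hevent] with t ht
    rw [(hasDerivAt_sqrt_div_add hl (c := -2) (by linarith)).deriv]
    field_simp
  have hmean : ∫ ω, W ω ∂P = 1 / l := by
    rw [← deriv_mgf_zero hmem, hmgf.deriv_eq, hd.self_of_nhds]
    simp [hl.ne']
  have hsq : ∫ ω, W ω ^ 2 ∂P = 3 / l ^ 2 := by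
    have h := iteratedDeriv_mgf_zero hmem 2
    simp only [Pi.pow_apply] at h
    have h3 : HasDerivAt (fun t => 1 / l * √(l / (l + (-2) * t)) ^ 3) _ 0 :=
      ((hasDerivAt_sqrt_div_add hl (c := -2) (a := 0) (by simpa using hl)).pow 3).const_mul (1 / l)
    rw [← h, iteratedDeriv_succ, iteratedDeriv_one, (hmgf.deriv.trans hd).deriv_eq, h3.deriv]
    simp [hl.ne']
    field_simp
  have hL : MemLp W 2 P := memLp_of_mem_interior_integrableExpSet hmem 2
  refine ⟨hL, hmean, ?_⟩
  rw [variance_eq_sub hL, hmean]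
  simp only [Pi.pow_apply]
  rw [hsq]
  field_simp
  ring

end InverseGaussianSample

/-! ### The estimator: Stein form and maximum likelihood -/

lemma sum_invGaussianDeviation {ι : Type*} (s : Finset ι) {μ : ℝ} (hμ : μ ≠ 0) {x : ι → ℝ}
    (hx : ∀ i ∈ s, 0 < x i) :
    ∑ i ∈ s, invGaussianDeviation μ (x i) =
      ∑ i ∈ s, 1 / x i - 2 * s.card / μ + (∑ i ∈ s, x i) / μ ^ 2 := by
  have h : ∀ i ∈ s, invGaussianDeviation μ (x i) = 1 / x i - 2 / μ + x i / μ ^ 2 := fun i hi => by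
    have := (hx i hi).ne'
    unfold invGaussianDeviation
    field_simp
    ring
  rw [Finset.sum_congr rfl h, Finset.sum_add_distrib, Finset.sum_sub_distrib, Finset.sum_div]
  simp
  ring

theorem steinEstimatorIG_one_div {n : ℕ} {x : Fin n → ℝ} (hx : ∀ i, 0 < x i) :
    steinEstimatorIG (fun t => 1 / t) x = mlEstimatorIG x := by
  rcases Nat.eq_zero_or_pos n with rfl | hn
  · simp [steinEstimatorIG, mlEstimatorIG, sampleMean]
  have hn' : (0 : ℝ) < n := by exact_mod_cast hn
  have hS : 0 < sampleMean x := by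
    have : Nonempty (Fin n) := ⟨⟨0, hn⟩⟩
    exact div_pos (Finset.sum_pos (fun i _ => hx i) Finset.univ_nonempty) hn'
  have h1 : (fun i => x i ^ 2 * deriv (fun t : ℝ => 1 / t) (x i)) = fun _ => -1 := by
    ext i
    have := (hx i).ne'
    simp only [one_div, deriv_inv]
    field_simp
  have h2 : (fun i => x i * (1 / x i)) = fun _ => 1 := by
    ext i
    have := (hx i).ne'
    field_simp
  have h3 : (fun i => x i ^ 2 * (1 / x i)) = x := by
    ext i
    have := (hx i).ne'
    field_simp
  have hm1 : sampleMean (fun _ : Fin n => (-1 : ℝ)) = -1 := by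
    simp [sampleMean, hn'.ne']
  have hm2 : sampleMean (fun _ : Fin n => (1 : ℝ)) = 1 := by
    simp [sampleMean, hn'.ne']
  rw [steinEstimatorIG, mlEstimatorIG, h1, h2, h3, hm1, hm2]
  set a := sampleMean x
  set b := sampleMean fun i => 1 / x i
  -- Only the nonzero factor `-a` is cancelled, so constant data, where both denominators vanish,
  -- are covered too.
  rw [show a ^ 2 * (2 * -1 + 1) = -a * a by ring, show a - a ^ 2 * b = -a * (a * b - 1) by ring,
    mul_div_mul_left _ _ (neg_ne_zero.2 hS.ne')]

lemma mlEstimatorIG_eq {n : ℕ} (hn : 0 < n) {x : Fin n → ℝ} (hx : ∀ i, 0 < x i) :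
    mlEstimatorIG x = n / (∑ i, 1 / x i - n ^ 2 / ∑ i, x i) := by
  have hn' : (n : ℝ) ≠ 0 := by exact_mod_cast hn.ne'
  have : Nonempty (Fin n) := ⟨⟨0, hn⟩⟩
  have hS : 0 < ∑ i, x i := Finset.sum_pos (fun i _ => hx i) Finset.univ_nonempty
  unfold mlEstimatorIG sampleMean
  set S := ∑ i, x i
  set R := ∑ i, 1 / x i
  rw [show S / n * (R / n) - 1 = (S * R - n ^ 2) / n ^ 2 by field_simp,
    show R - n ^ 2 / S = (S * R - n ^ 2) / S by field_simp, div_div_eq_mul_div, div_div_eq_mul_div]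
  congr 1
  field_simp

lemma invGaussianPDFReal_eq_mul_exp {μ l x : ℝ} (hμ : 0 < μ) (hl : 0 < l) (hx : 0 < x) :
    invGaussianPDFReal μ l x = √(1 / (2 * Real.pi)) * x ^ (-(3 / 2 : ℝ)) *
      Real.exp (Real.log l / 2 - l / 2 * invGaussianDeviation μ x) := by
  have h : √l = Real.exp (Real.log l / 2) := by
    rw [Real.sqrt_eq_rpow, Real.rpow_def_of_pos hl]
    ring_nf
  rw [invGaussianPDFReal_of_pos hμ hx, sub_eq_add_neg, Real.exp_add, ← h, ← neg_mul,
    show l / (2 * Real.pi) = 1 / (2 * Real.pi) * l by ring, Real.sqrt_mul (by positivity)]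
  ring

lemma invGaussianLikelihood_eq {n : ℕ} {x : Fin n → ℝ} (hx : ∀ i, 0 < x i) {μ l : ℝ} (hμ : 0 < μ)
    (hl : 0 < l) :
    invGaussianLikelihood x μ l = (∏ i, (√(1 / (2 * Real.pi)) * x i ^ (-(3 / 2 : ℝ)))) *
      Real.exp (n / 2 * Real.log l - l / 2 * ∑ i, invGaussianDeviation μ (x i)) := by
  rw [invGaussianLikelihood,
    Finset.prod_congr rfl fun i _ => invGaussianPDFReal_eq_mul_exp hμ hl (hx i),
    Finset.prod_mul_distrib, ← Real.exp_sum, Finset.sum_sub_distrib, ← Finset.mul_sum]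
  congr 2
  simp
  ring

/-- Since `∑ W_m(xᵢ) = V + (∑ xᵢ)(1 / m - 1 / x̄)²`, the mean is optimal for every `l'`. What
remains is `log r < r - 1` for the ratio `r ≠ 1` of `l'` to the estimate. Non-constant data ensure
`V > 0`. -/
theorem mlEstimatorIG_isMaximum {n : ℕ} {x : Fin n → ℝ} (hx : ∀ i, 0 < x i)
    (hne : ∃ i j, x i ≠ x j) :
    0 < sampleMean x ∧ 0 < mlEstimatorIG x ∧
      ∀ μ' l' : ℝ, 0 < μ' → 0 < l' → (μ', l') ≠ (sampleMean x, mlEstimatorIG x) →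
        invGaussianLikelihood x μ' l' <
          invGaussianLikelihood x (sampleMean x) (mlEstimatorIG x) := by
  obtain ⟨i, j, hij⟩ := hne
  have hn : 0 < n := i.pos
  have hn' : (0 : ℝ) < n := by exact_mod_cast hn
  have : Nonempty (Fin n) := ⟨i⟩
  have hS : 0 < ∑ i, x i := Finset.sum_pos (fun i _ => hx i) Finset.univ_nonempty
  have hmean : 0 < sampleMean x := div_pos hS hn'
  have hml := mlEstimatorIG_eq hn hx
  set V := ∑ i, 1 / x i - n ^ 2 / ∑ i, x i with hV
  have hdev : ∀ m : ℝ, 0 < m → ∑ i, invGaussianDeviation m (x i) =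
      V + (∑ i, x i) * (1 / m - 1 / sampleMean x) ^ 2 := fun m hm => by
    rw [sum_invGaussianDeviation _ hm.ne' fun i _ => hx i, hV, sampleMean, Finset.card_univ,
      Fintype.card_fin]
    field_simp
    ring
  have hdev0 : ∑ i, invGaussianDeviation (sampleMean x) (x i) = V := by
    rw [hdev _ hmean]; simp
  have hVpos : 0 < V := by
    obtain ⟨k, hk⟩ : ∃ k, x k ≠ sampleMean x := by
      by_contra! h
      exact hij ((h i).trans (h j).symm)
    rw [← hdev0]
    refine Finset.sum_pos' (fun i _ => ?_) ⟨k, Finset.mem_univ k, ?_⟩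
    · have := hx i
      unfold invGaussianDeviation
      positivity
    · have := hx k
      have := sub_ne_zero.2 hk
      unfold invGaussianDeviation
      positivity
  have hmlpos : 0 < mlEstimatorIG x := by rw [hml]; positivity
  refine ⟨hmean, hmlpos, fun μ' l' hμ' hl' hneq => ?_⟩
  rw [invGaussianLikelihood_eq hx hμ' hl', invGaussianLikelihood_eq hx hmean hmlpos, hdev0,
    hdev _ hμ']
  refine mul_lt_mul_of_pos_left (Real.exp_lt_exp.2 ?_) (Finset.prod_pos fun i _ => by
    have := hx i
    positivity)
  set L := mlEstimatorIG x
  have hVL : V = n / L := by rw [hml]; field_simp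
  have hquad : 0 ≤ l' / 2 * ((∑ i, x i) * (1 / μ' - 1 / sampleMean x) ^ 2) := by positivity
  have hlog : Real.log l' = Real.log L + Real.log (l' / L) := by
    rw [Real.log_div hl'.ne' hmlpos.ne']; ring
  have hone : L / 2 * V = n / 2 := by rw [hVL]; field_simp
  have htwo : l' / 2 * V = n / 2 * (l' / L) := by rw [hVL]; field_simp
  rw [mul_add, hone, htwo, hlog]
  by_cases hlL : l' = L
  · have hμne : μ' ≠ sampleMean x := fun h => hneq (by rw [h, hlL])
    have hpos : 0 < l' / 2 * ((∑ i, x i) * (1 / μ' - 1 / sampleMean x) ^ 2) := by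
      have : 1 / μ' - 1 / sampleMean x ≠ 0 := by
        rw [sub_ne_zero, one_div, one_div]
        exact fun h => hμne (inv_injective h)
      positivity
    have h1 : l' / L = 1 := by rw [hlL, div_self hmlpos.ne']
    rw [h1, Real.log_one]
    linarith
  · have h1 : l' / L ≠ 1 := fun h => hlL ((div_eq_one_iff_eq hmlpos.ne').1 h)
    have h2 := mul_lt_mul_of_pos_left
      (Real.log_lt_sub_one_of_pos (div_pos hl' hmlpos) h1) (half_pos hn')
    linarith

/-! ### Asymptotic normality and bias -/

lemma tendstoInDistribution_of_identDistrib_succ {Ω Ω' E : Type*} [MeasurableSpace Ω]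
    [MeasurableSpace Ω'] [TopologicalSpace E] [MeasurableSpace E] [OpensMeasurableSpace E]
    {P : Measure Ω} [IsProbabilityMeasure P] {P' : Measure Ω'} [IsProbabilityMeasure P']
    {X Y : ℕ → Ω → E} {Z : Ω' → E} (h : TendstoInDistribution X atTop Z (fun _ => P) P')
    (hY : ∀ n, AEMeasurable (Y n) P)
    (hXY : ∀ᶠ n in atTop, IdentDistrib (X n) (Y (n + 1)) P P) :
    TendstoInDistribution Y atTop Z (fun _ => P) P' where
  forall_aemeasurable := hY
  aemeasurable_limit := h.aemeasurable_limit
  tendsto := by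
    refine (tendsto_add_atTop_iff_nat 1).1 (h.tendsto.congr' ?_)
    filter_upwards [hXY] with n hn
    exact Subtype.ext hn.map_eq

lemma aemeasurable_mlEstimatorIG {Ω : Type*} [MeasurableSpace Ω] {P : Measure Ω} {X : ℕ → Ω → ℝ}
    (hX : ∀ i, AEMeasurable (X i) P) (n : ℕ) :
    AEMeasurable (fun ω => mlEstimatorIG (fun i : Fin n => X i ω)) P := by
  unfold mlEstimatorIG sampleMean
  fun_prop

section InverseGaussianSequence

variable {Ω : Type*} [MeasurableSpace Ω] {P : Measure Ω} [IsProbabilityMeasure P] {μ l : ℝ}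
  {X : ℕ → Ω → ℝ}

/-- The `n`-th maximum likelihood estimate is distributed as `n / T`, where `T` is the sum of
`n - 1` independent deviations. -/
theorem identDistrib_mlEstimatorIG (hμ : 0 < μ) (hl : 0 < l)
    (hlaw : ∀ i, HasLaw (X i) (invGaussianMeasure μ l) P) (hindep : iIndepFun X P) (m : ℕ) :
    IdentDistrib (fun ω => ((m + 1 : ℕ) : ℝ) /
        ∑ i ∈ Finset.range m, invGaussianDeviation μ (X i ω))
      (fun ω => mlEstimatorIG (fun i : Fin (m + 1) => X i ω)) P P := by
  have h := (identDistrib_invGaussianResidual hμ hl hlaw hindep (s := Finset.range (m + 1))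
    (r := Finset.range m) (by simp)).comp (u := fun v : ℝ => ((m + 1 : ℕ) : ℝ) / v) (by fun_prop)
  refine h.symm.trans (IdentDistrib.of_ae_eq h.aemeasurable_fst ?_)
  filter_upwards [ae_all_iff.2 fun i => ae_sample_pos_and_ne hlaw 0 i] with ω hω
  have hS : 0 < ∑ i ∈ Finset.range (m + 1), X i ω :=
    Finset.sum_pos (fun i _ => (hω i).1) (by simp)
  rw [mlEstimatorIG_eq m.succ_pos fun i => (hω i).1,
    Fin.sum_univ_eq_sum_range (fun i => X i ω), Fin.sum_univ_eq_sum_range (fun i => 1 / X i ω)]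
  simp only [Function.comp, invGaussianResidual, Finset.card_range]
  rw [sum_invGaussianDeviation _ hμ.ne' fun i _ => (hω i).1, Finset.card_range]
  -- All terms in `μ` cancel, so the residual is `∑ 1 / Xᵢ - n² / ∑ Xᵢ`.
  congr 1
  have hm : ((m + 1 : ℕ) : ℝ) ≠ 0 := by positivity
  unfold invGaussianDeviation
  field_simp
  ring

theorem tendstoInDistribution_mlEstimatorIG (hμ : 0 < μ) (hl : 0 < l)
    (hlaw : ∀ i, HasLaw (X i) (invGaussianMeasure μ l) P) (hindep : iIndepFun X P) :
    TendstoInDistribution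
      (fun (n : ℕ) ω => √n * (mlEstimatorIG (fun i : Fin n => X i ω) - l))
      atTop (fun y : ℝ => y) (fun _ => P) (gaussianReal 0 (2 * l ^ 2).toNNReal) := by
  set W : ℕ → Ω → ℝ := fun i ω => invGaussianDeviation μ (X i ω) with hW
  have hident : ∀ i, IdentDistrib (W i) (W 0) P P := fun i =>
    (IdentDistrib.mk (hlaw i).aemeasurable (hlaw 0).aemeasurable
      ((hlaw i).map_eq.trans (hlaw 0).map_eq.symm)).comp (measurable_invGaussianDeviation μ)
  have hindepW : iIndepFun W P :=
    hindep.comp (fun _ => invGaussianDeviation μ) fun _ => measurable_invGaussianDeviation μ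
  obtain ⟨hL2, hmean, hvar⟩ := memLp_and_moments_deviation hμ hl (hlaw 0)
  -- The Gaussian limit of variance `2 / l²` is realized as `-y / l²`, so that the limiting Slutsky
  -- factor `-l²` turns it into `y` itself.
  have hlimit : HasLaw (fun y : ℝ => -(1 / l ^ 2) * y) (gaussianReal 0 Var[W 0; P].toNNReal)
      (gaussianReal 0 (2 * l ^ 2).toNNReal) := by
    convert! gaussianReal_const_mul (HasLaw.id (μ := gaussianReal 0 (2 * l ^ 2).toNNReal))
      (-(1 / l ^ 2)) using 2
    · simp
    · rw [hvar]
      apply NNReal.coe_injective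
      rw [Real.coe_toNNReal _ (by positivity), NNReal.coe_mul,
        Real.coe_toNNReal _ (by positivity)]
      simp only [NNReal.coe_mk]
      field_simp
  have hclt := tendstoInDistribution_inv_sqrt_mul_sum_sub hlimit hL2 hindepW hident
  rw [show ∫ ω, W 0 ω ∂P = 1 / l from hmean] at hclt
  have hslln := strong_law_ae_real W (hL2.integrable (by norm_num))
    (fun i j hij => hindepW.indepFun hij) hident
  rw [show ∫ ω, W 0 ω ∂P = 1 / l from hmean] at hslln
  have hWm : ∀ i, AEMeasurable (W i) P := fun i => (hident i).aemeasurable_fst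
  set T : ℕ → Ω → ℝ := fun m ω => ∑ i ∈ Finset.range m, W i ω with hT
  have hTm : ∀ m, AEMeasurable (T m) P := fun m => by fun_prop
  -- Slope and intercept of `√(m+1) ((m+1) / T - l)` as an affine function of `(T - m / l) / √m`. By
  -- the strong law `T / m → 1 / l`, so they tend to `-l²` and `0`.
  set C : ℕ → Ω → ℝ × ℝ := fun m ω =>
    (-l * √(1 + 1 / m) / (T m ω / m), √(1 + 1 / m) * √(1 / m) / (T m ω / m)) with hC
  have hCm : ∀ m, AEMeasurable (C m) P := fun m => by
    have := hTm m
    fun_prop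
  have hClim : TendstoInMeasure P C atTop fun _ => (-l ^ 2, 0) := by
    refine tendstoInMeasure_of_tendsto_ae (fun m => (hCm m).aestronglyMeasurable) ?_
    filter_upwards [hslln] with ω hω
    have h0 : Tendsto (fun m : ℕ => √(1 / (m : ℝ))) atTop (𝓝 0) := by
      simpa using (tendsto_one_div_atTop_nhds_zero_nat (𝕜 := ℝ)).sqrt
    have h1 : Tendsto (fun m : ℕ => √(1 + 1 / (m : ℝ))) atTop (𝓝 1) := by
      simpa using ((tendsto_one_div_atTop_nhds_zero_nat (𝕜 := ℝ)).const_add 1).sqrt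
    have hl1 : 1 / l ≠ 0 := by positivity
    refine Tendsto.prodMk_nhds ?_ ?_
    · convert! (h1.const_mul (-l)).div hω hl1 using 2
      field_simp
    · convert! (h1.mul h0).div hω hl1 using 2
      simp
  have hslutsky := hclt.continuous_comp_prodMk_of_tendstoInMeasure_const
    (g := fun p : ℝ × (ℝ × ℝ) => p.2.1 * p.1 + p.2.2) (by fun_prop) hClim hCm
  have hZ : (fun y : ℝ => -l ^ 2 * (-(1 / l ^ 2) * y) + 0) = fun y => y := by
    ext y
    field_simp
    ring
  simp only [hZ] at hslutsky
  refine tendstoInDistribution_of_identDistrib_succ hslutsky (fun n => ?_) ?_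
  · have := aemeasurable_mlEstimatorIG (fun i => (hlaw i).aemeasurable) n
    fun_prop
  · filter_upwards [eventually_gt_atTop 0] with m hm
    have h := (identDistrib_mlEstimatorIG hμ hl hlaw hindep m).comp
      (u := fun v : ℝ => √((m + 1 : ℕ) : ℝ) * (v - l)) (by fun_prop)
    refine IdentDistrib.trans (IdentDistrib.of_ae_eq (hslutsky.forall_aemeasurable m) ?_) h
    filter_upwards [ae_sum_deviation_pos hμ hlaw (s := Finset.range m) (by simpa using hm.ne')]
      with ω hω
    have hm' : (0 : ℝ) < m := by exact_mod_cast hm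
    change 0 < T m ω at hω
    change -l * √(1 + 1 / m) / (T m ω / m) * ((√m)⁻¹ * (T m ω - m * (1 / l))) +
      √(1 + 1 / m) * √(1 / m) / (T m ω / m) = √((m + 1 : ℕ) : ℝ) * (((m + 1 : ℕ) : ℝ) / T m ω - l)
    have hs : √(1 + 1 / (m : ℝ)) = √((m + 1 : ℕ) : ℝ) / √m := by
      rw [← Real.sqrt_div (by positivity)]
      congr 1
      push_cast
      field_simp
    rw [hs, Real.sqrt_div zero_le_one, Real.sqrt_one]
    have hsq : √(m : ℝ) ^ 2 = m := Real.sq_sqrt hm'.le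
    have hs0 : √(m : ℝ) ≠ 0 := (Real.sqrt_pos.2 hm').ne'
    field_simp
    rw [hsq]
    push_cast
    ring

theorem integrable_and_integral_mlEstimatorIG (hμ : 0 < μ) (hl : 0 < l)
    (hlaw : ∀ i, HasLaw (X i) (invGaussianMeasure μ l) P) (hindep : iIndepFun X P) (k : ℕ) :
    Integrable (fun ω => mlEstimatorIG (fun i : Fin (k + 4) => X i ω)) P ∧
      ∫ ω, mlEstimatorIG (fun i : Fin (k + 4) => X i ω) ∂P = (k + 4) * l / (k + 1) := by
  have hid := identDistrib_mlEstimatorIG hμ hl hlaw hindep (k + 3)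
  obtain ⟨hint, hval⟩ := integrable_and_integral_inv_sum_deviation hμ hl hlaw hindep
    (s := Finset.range (k + 3)) (Finset.card_range _)
  have hdiv : (fun ω => ((k + 3 + 1 : ℕ) : ℝ) /
      ∑ i ∈ Finset.range (k + 3), invGaussianDeviation μ (X i ω)) =
      fun ω => ((k : ℝ) + 4) * (1 / ∑ i ∈ Finset.range (k + 3), invGaussianDeviation μ (X i ω)) := by
    ext ω
    push_cast
    ring
  rw [hdiv] at hid
  refine ⟨hid.integrable_iff.1 (hint.const_mul _), ?_⟩
  rw [← hid.integral_eq, integral_const_mul, hval]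
  ring

end InverseGaussianSequence

theorem mainTheorem9 {Ω : Type*} [MeasurableSpace Ω] (P : Measure Ω) [IsProbabilityMeasure P]
    (μ l : ℝ) (hμ : 0 < μ) (hl : 0 < l)
    (X : ℕ → Ω → ℝ) (hlaw : ∀ i, HasLaw (X i) (invGaussianMeasure μ l) P)
    (hindep : iIndepFun X P) :
    -- the estimator is the Stein-type moment estimator with `f(x) = 1/x`
    (∀ (n : ℕ) (x : Fin n → ℝ), (∀ i, 0 < x i) →
      steinEstimatorIG (fun t => 1 / t) x = mlEstimatorIG x) ∧
    -- for non-constant data it is, together with the mean, the unique maximum likelihood estimate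
    (∀ (n : ℕ) (x : Fin n → ℝ), (∀ i, 0 < x i) → (∃ i j, x i ≠ x j) →
      0 < sampleMean x ∧ 0 < mlEstimatorIG x ∧
      ∀ μ' l' : ℝ, 0 < μ' → 0 < l' → (μ', l') ≠ (sampleMean x, mlEstimatorIG x) →
        invGaussianLikelihood x μ' l' <
          invGaussianLikelihood x (sampleMean x) (mlEstimatorIG x)) ∧
    -- asymptotic normality with asymptotic variance `2 l² / n`
    TendstoInDistribution
      (fun (n : ℕ) ω => Real.sqrt n * (mlEstimatorIG (fun i : Fin n => X i ω) - l))
      atTop (fun y : ℝ => y) (fun _ => P) (gaussianReal 0 (2 * l ^ 2).toNNReal) ∧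
    -- asymptotic bias `3 l / n`, that is, the bias equals `3 l / n + o(1 / n)`
    (∀ᶠ n : ℕ in atTop, Integrable (fun ω => mlEstimatorIG (fun i : Fin n => X i ω)) P) ∧
    Tendsto (fun n : ℕ =>
        (n : ℝ) * ((∫ ω, mlEstimatorIG (fun i : Fin n => X i ω) ∂P) - l))
      atTop (𝓝 (3 * l)) := by
  have hbias := integrable_and_integral_mlEstimatorIG hμ hl hlaw hindep
  refine ⟨fun n x hx => steinEstimatorIG_one_div hx, fun n x hx => mlEstimatorIG_isMaximum hx,
    tendstoInDistribution_mlEstimatorIG hμ hl hlaw hindep, ?_, ?_⟩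
  · filter_upwards [eventually_ge_atTop 4] with n hn
    obtain ⟨k, rfl⟩ := Nat.exists_eq_add_of_le' hn
    exact (hbias k).1
  · refine (tendsto_add_atTop_iff_nat 4).1 ?_
    -- With `n = k + 4`, `n (n l / (n - 3) - l) = 3 l n / (n - 3) = 3 l (1 + 3 / (k + 1))`.
    have h : Tendsto (fun k : ℕ => 3 * l * (1 + 3 * (1 / ((k : ℝ) + 1)))) atTop (𝓝 (3 * l)) := by
      simpa using (((tendsto_one_div_add_atTop_nhds_zero_nat (𝕜 := ℝ)).const_mul 3).const_add
        1).const_mul (3 * l)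
    refine h.congr fun k => ?_
    rw [(hbias k).2]
    push_cast
    field_simp
    ring
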